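/- **Setting.** Let $T_1<T_2$, $p\in\mathbb N$, $H_n=L^2([T_1,T_2])^n$, and let $\mathcal S:H_{p+1}\to H_{p+1}$ be a bounded linear operator (in the structural equation model $(Y,X)=\mathcal T(Y,X)+A+\epsilon$, $\mathcal S=(I-\mathcal T)^{-1}$). On a probability space $(\Omega,\mathcal F,\mathbb P)$ let $\mathcal V=L^2(\Omega,\mathbb P;H_{p+1})$ be the space of square-integrable $H_{p+1}$-valued random elements, with norm $\|A\|_{\mathcal V}=(\mathbb E\|A\|_{H_{p+1}}^2)^{1/2}$, and let the noise $\epsilon\in\mathcal V$ satisfy $\mathbb E[\epsilon]=0$. For every shift $A'\in\mathcal V$ let $(\Omega_{A'},\mathbb P_{A'})$ be an extension of $(\Omega,\mathbb P)$ that carries a copy $\epsilon_{A'}$ of $\epsilon$ (same law) independent of $A'$, and put $$(Y^{A'},X^{A'})=\mathcal S(A'+\epsilon_{A'}),\qquad Y^{A'}\in L^2([T_1,T_2]),\quad X^{A'}\in H_p .$$ The observational environment $O$ is the one with shift $0$. For $\beta\in L^2([T_1,T_2]^2)^p$ the risk is $$R_{A'}(\beta)=\mathbb E_{A'}\int_{T_1}^{T_2}\Big(Y^{A'}_t-\sum_{i=1}^p\int_{T_1}^{T_2}\beta_i(t,\tau)X^{A'}_\tau(i)\,d\tau\Big)^2dt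 .$$ For a random element $U$ of $H_n$ let $K_U(s,t)=\mathbb E[U_s^{T}U_t]$ be its (uncentred, $n\times n$-matrix valued) covariance kernel, elements of $H_n$ being row vectors. For $\mathcal A\subseteq\mathcal V$, $A\in\mathcal V$ and $\gamma\ge 0$ let $$C^\gamma_{\mathcal A}(A)=\Big\{A'\in\mathcal A:\ \iint g(s)K_{A'}(s,t)g(t)^T\,ds\,dt\le\gamma\iint g(s)K_{A}(s,t)g(t)^T\,ds\,dt\ \text{ for all } g\in H_{p+1}\Big\},$$ and assume that $\sqrt\gamma A$ belongs to the closure of $C^\gamma_{\mathcal A}(A)$ in $\mathcal V$ (for instance, $\sqrt\gamma A\in\mathcal A$). Let $\mathcal K$ be the covariance operator of $X^{\sqrt\gamma A}$ on $H_p$, $(\mathcal Kf)(t)=\int_{T_1}^{T_2} f(s)K_{X^{\sqrt\gamma A}}(s,t)\,ds$, let $(\psi_l)_l$ (finitely or infinitely many) be an orthonormal family of eigenfunctions of $\mathcal K$ with non-zero eigenvalues such that $(\operatorname{span}\{\psi_l\})^\perp=\operatorname{Ker}\mathcal K$, and let $(\phi_k)_{k\in\mathbb N}$ be any orthonormal basis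 of $L^2([T_1,T_2])$. Put $Z_k^{A'}=\langle Y^{A'},\phi_k\rangle$ and $\chi_l^{A'}=\langle X^{A'},\psi_l\rangle$ for $A'\in\{A,O\}$, $(\phi\otimes\psi)(t,\tau)=\phi(t)\psi(\tau)$, and $$c_{k,l}=\frac{\gamma\,\mathbb E_A[Z_k^A\chi_l^A]+(1-\gamma)\,\mathbb E_O[Z_k^O\chi_l^O]}{\gamma\,\mathbb E_A[(\chi_l^A)^2]+(1-\gamma)\,\mathbb E_O[(\chi_l^O)^2]} .$$ Let $W$ be the closed linear span of $\{f\otimes\eta: f\in L^2([T_1,T_2]),\ \eta\in\operatorname{Ker}\mathcal K\}$ in $L^2([T_1,T_2]^2)^p$. **Theorem 4.1.** Suppose $\sum_{k,l}c_{k,l}^2<\infty$. Then $\sum_{k,l}c_{k,l}\,\phi_k\otimes\psi_l$ converges unconditionally in $L^2([T_1,T_2]^2)^p$, and $$\operatorname*{arg\,min}_{\beta\in L^2([T_1,T_2]^2)^p}\ \sup_{A'\in C^\gamma_{\mathcal A}(A)}R_{A'}(\beta)=\Big\{\sum_{k,l}c_{k,l}\,\phi_k\otimes\psi_l\Big\}+W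 .$$ Moreover, the minimizer is unique if and only if $\mathcal K$ is injective. -/

import Mathlib

open MeasureTheory ProbabilityTheory
open scoped ENNReal InnerProductSpace

noncomputable section

namespace FunctionalSEM

universe u v w

/-! ### The function spaces -/

/-- Lebesgue measure on the time interval `[T₁, T₂]`. -/
abbrev timeMeasure (T₁ T₂ : ℝ) : Measure ℝ := volume.restrict (Set.Icc T₁ T₂)

/-- `L²([T₁, T₂])`. -/
abbrev L2 (T₁ T₂ : ℝ) := Lp ℝ 2 (timeMeasure T₁ T₂)

/-- `L²([T₁, T₂]²)`. -/
abbrev L2Sq (T₁ T₂ : ℝ) := Lp ℝ 2 ((timeMeasure T₁ T₂).prod (timeMeasure T₁ T₂))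

/-- `L²([T₁, T₂])ⁿ` with its Hilbert space structure. -/
abbrev L2Vec (n : ℕ) (T₁ T₂ : ℝ) := PiLp 2 (fun _ : Fin n => L2 T₁ T₂)

/-- `L²([T₁, T₂]²)ⁿ` with its Hilbert space structure: the regression kernels. -/
abbrev L2SqVec (n : ℕ) (T₁ T₂ : ℝ) := PiLp 2 (fun _ : Fin n => L2Sq T₁ T₂)

/-- `L²([T₁, T₂])` carries its Borel σ-algebra. (The σ-algebra on `L2Vec n T₁ T₂` is the product
one, which is its Borel σ-algebra because `L²` is separable.) -/
instance instMeasurableSpaceL2 (T₁ T₂ : ℝ) : MeasurableSpace (L2 T₁ T₂) := borel _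

instance instBorelSpaceL2 (T₁ T₂ : ℝ) : BorelSpace (L2 T₁ T₂) := ⟨rfl⟩

instance instSecondCountableTopologyL2 (T₁ T₂ : ℝ) : SecondCountableTopology (L2 T₁ T₂) :=
  haveI : Fact ((2 : ℝ≥0∞) ≠ ∞) := ⟨by norm_num⟩
  Lp.SecondCountableTopology

variable {T₁ T₂ : ℝ}

/-! ### Tensor products -/

theorem memLp_tensor (f g : L2 T₁ T₂) :
    MemLp (fun z : ℝ × ℝ => f z.1 * g z.2) 2
      ((timeMeasure T₁ T₂).prod (timeMeasure T₁ T₂)) := by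
  have hf := Lp.memLp f
  have hg := Lp.memLp g
  have hm : AEStronglyMeasurable (fun z : ℝ × ℝ => f z.1 * g z.2)
      ((timeMeasure T₁ T₂).prod (timeMeasure T₁ T₂)) :=
    hf.aestronglyMeasurable.comp_fst.mul hg.aestronglyMeasurable.comp_snd
  rw [memLp_two_iff_integrable_sq hm]
  have h := hf.integrable_sq.mul_prod hg.integrable_sq
  refine h.congr (Filter.Eventually.of_forall fun z => ?_)
  simp only [mul_pow]

/-- `(f ⊗ g)(t, τ) = f(t) g(τ)`, as an element of `L²([T₁, T₂]²)`. -/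
def tensor (f g : L2 T₁ T₂) : L2Sq T₁ T₂ := (memLp_tensor f g).toLp _

/-- `f ⊗ g = (f ⊗ g₁, …, f ⊗ gₙ)` for `f ∈ L²([T₁, T₂])` and `g ∈ L²([T₁, T₂])ⁿ`. -/
def tensorVec {n : ℕ} (f : L2 T₁ T₂) (g : L2Vec n T₁ T₂) : L2SqVec n T₁ T₂ :=
  WithLp.toLp 2 (fun i => tensor f (g i))

/-! ### Integral operators and covariance operators -/

theorem integrable_kernel_mul (k : L2Sq T₁ T₂) (f : L2 T₁ T₂) :
    Integrable (fun z : ℝ × ℝ => k z * f z.1)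
      ((timeMeasure T₁ T₂).prod (timeMeasure T₁ T₂)) :=
  MemLp.integrable_mul (Lp.memLp k) ((Lp.memLp f).comp_fst _)

theorem memLp_kernelOp (k : L2Sq T₁ T₂) (f : L2 T₁ T₂) :
    MemLp (fun t => ∫ s, k (s, t) * f s ∂timeMeasure T₁ T₂) 2 (timeMeasure T₁ T₂) := by
  have hm : AEStronglyMeasurable (fun t => ∫ s, k (s, t) * f s ∂timeMeasure T₁ T₂)
      (timeMeasure T₁ T₂) :=
    (integrable_kernel_mul k f).integral_prod_right.aestronglyMeasurable
  rw [memLp_two_iff_integrable_sq hm]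
  have hk2 : Integrable (fun z : ℝ × ℝ => (k z) ^ 2)
      ((timeMeasure T₁ T₂).prod (timeMeasure T₁ T₂)) := (Lp.memLp k).integrable_sq
  have hdom : Integrable (fun t => (∫ s, (k (s, t)) ^ 2 ∂timeMeasure T₁ T₂)
      * ∫ s, (f s) ^ 2 ∂timeMeasure T₁ T₂) (timeMeasure T₁ T₂) :=
    hk2.integral_prod_right.mul_const _
  refine hdom.mono (hm.pow 2) ?_
  have hsw := (Lp.aestronglyMeasurable k).prod_swap.prodMk_left
  filter_upwards [hk2.prod_left_ae, hsw] with t ht htm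
  have hkt : MemLp (fun s => k (s, t)) 2 (timeMeasure T₁ T₂) :=
    (memLp_two_iff_integrable_sq htm).2 ht
  have hCS := integral_mul_norm_le_Lp_mul_Lq (μ := timeMeasure T₁ T₂)
    (Real.HolderConjugate.two_two) (f := fun s => k (s, t)) (g := fun s => f s)
    (by simpa using hkt) (by simpa using Lp.memLp f)
  have h1 : |∫ s, k (s, t) * f s ∂timeMeasure T₁ T₂| ≤
      ∫ s, ‖k (s, t)‖ * ‖f s‖ ∂timeMeasure T₁ T₂ := by
    have := norm_integral_le_integral_norm (μ := timeMeasure T₁ T₂) (fun s => k (s, t) * f s)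
    simpa only [norm_mul, Real.norm_eq_abs] using this
  have e : ∀ h : ℝ → ℝ, ∫ a, ‖h a‖ ^ (2 : ℝ) ∂timeMeasure T₁ T₂
      = ∫ a, (h a) ^ 2 ∂timeMeasure T₁ T₂ := by
    intro h
    congr 1
    funext a
    rw [show (2 : ℝ) = ((2 : ℕ) : ℝ) by norm_num, Real.rpow_natCast, Real.norm_eq_abs, sq_abs]
  rw [e, e, ← Real.sqrt_eq_rpow, ← Real.sqrt_eq_rpow] at hCS
  have p1 : 0 ≤ ∫ s, (k (s, t)) ^ 2 ∂timeMeasure T₁ T₂ := integral_nonneg fun _ => sq_nonneg _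
  have p2 : 0 ≤ ∫ s, (f s) ^ 2 ∂timeMeasure T₁ T₂ := integral_nonneg fun _ => sq_nonneg _
  rw [Real.norm_of_nonneg (sq_nonneg _), Real.norm_of_nonneg (mul_nonneg p1 p2)]
  calc (∫ s, k (s, t) * f s ∂timeMeasure T₁ T₂) ^ 2
      = |∫ s, k (s, t) * f s ∂timeMeasure T₁ T₂| ^ 2 := (sq_abs _).symm
    _ ≤ (√(∫ s, (k (s, t)) ^ 2 ∂timeMeasure T₁ T₂) *
          √(∫ s, (f s) ^ 2 ∂timeMeasure T₁ T₂)) ^ 2 := by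
        gcongr
        exact h1.trans hCS
    _ = _ := by rw [mul_pow, Real.sq_sqrt p1, Real.sq_sqrt p2]

/-- The integral operator `f ↦ (t ↦ ∫ k(s, t) f(s) ds)` on `L²([T₁, T₂])`. -/
def kernelOp (k : L2Sq T₁ T₂) : L2 T₁ T₂ →ₗ[ℝ] L2 T₁ T₂ where
  toFun f := (memLp_kernelOp k f).toLp _
  map_add' f g := by
    rw [← MemLp.toLp_add]
    refine MemLp.toLp_congr _ _ ?_
    filter_upwards [(integrable_kernel_mul k f).prod_left_ae,
      (integrable_kernel_mul k g).prod_left_ae] with t hf hg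
    rw [Pi.add_apply, ← integral_add hf hg]
    refine integral_congr_ae ?_
    filter_upwards [Lp.coeFn_add f g] with s hs
    rw [hs, Pi.add_apply, mul_add]
  map_smul' c f := by
    rw [RingHom.id_apply, ← MemLp.toLp_const_smul]
    refine MemLp.toLp_congr _ _ (Filter.Eventually.of_forall fun t => ?_)
    simp only [Pi.smul_apply, smul_eq_mul]
    rw [← integral_const_mul]
    refine integral_congr_ae ?_
    filter_upwards [Lp.coeFn_smul c f] with s hs
    rw [hs, Pi.smul_apply, smul_eq_mul]
    ring

/-- The (uncentred) covariance kernel `K_U(s, t) = E[U_sᵀ U_t]` of an `L²([T₁, T₂])ⁿ`-valued random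
element `U`; its entry `(i, j)` is the element `E[U(i) ⊗ U(j)]` of `L²([T₁, T₂]²)`, i.e.
`(s, t) ↦ E[U_s(i) U_t(j)]`. -/
def covKernel {n : ℕ} {Ω : Type*} [MeasurableSpace Ω] (P : Measure Ω) (U : Ω → L2Vec n T₁ T₂)
    (i j : Fin n) : L2Sq T₁ T₂ :=
  ∫ ω, tensor (U ω i) (U ω j) ∂P

/-- The covariance operator `(𝒦_U f)(t) = ∫ f(s) K_U(s, t) ds` on `L²([T₁, T₂])ⁿ`
(row vector times matrix). -/
def covOp {n : ℕ} {Ω : Type*} [MeasurableSpace Ω] (P : Measure Ω) (U : Ω → L2Vec n T₁ T₂) :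
    L2Vec n T₁ T₂ →ₗ[ℝ] L2Vec n T₁ T₂ where
  toFun f := WithLp.toLp 2 (fun j => ∑ i, kernelOp (covKernel P U i j) (f i))
  map_add' f g := by
    ext1 j
    simp [Finset.sum_add_distrib]
  map_smul' c f := by
    ext1 j
    simp [Finset.smul_sum]

/-- `∫∫ (g₁(s), …, gₙ(s)) K_U(s, t) (g₁(t), …, gₙ(t))ᵀ ds dt`. -/
def covForm {n : ℕ} {Ω : Type*} [MeasurableSpace Ω] (P : Measure Ω) (U : Ω → L2Vec n T₁ T₂)
    (g : L2Vec n T₁ T₂) : ℝ :=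
  ∫ z : ℝ × ℝ, ∑ i, ∑ j, g i z.1 * covKernel P U i j z * g j z.2
    ∂((timeMeasure T₁ T₂).prod (timeMeasure T₁ T₂))

/-- `ψ` is an orthonormal family of eigenvectors of `𝒦` with non-zero eigenvalues that exhausts
`𝒦`: the orthogonal complement of its span is the kernel of `𝒦`. These are the eigenfunctions in
the Hilbert–Schmidt expansion of a compact self-adjoint operator `𝒦`. The index type is arbitrary:
it is finite when `𝒦` has finite rank. -/
structure IsEigenfamily {n : ℕ} {ι : Type*} (𝒦 : L2Vec n T₁ T₂ →ₗ[ℝ] L2Vec n T₁ T₂)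
    (ψ : ι → L2Vec n T₁ T₂) : Prop where
  orthonormal : Orthonormal ℝ ψ
  eigen : ∀ l, ∃ α : ℝ, α ≠ 0 ∧ 𝒦 (ψ l) = α • ψ l
  exhaust : (Submodule.span ℝ (Set.range ψ))ᗮ = LinearMap.ker 𝒦

/-- The closed linear span in `L²([T₁, T₂]²)ⁿ` of all `f ⊗ η` with `f ∈ L²([T₁, T₂])` and
`η ∈ Ker 𝒦`. -/
def nullSpace {n : ℕ} (𝒦 : L2Vec n T₁ T₂ →ₗ[ℝ] L2Vec n T₁ T₂) :
    Submodule ℝ (L2SqVec n T₁ T₂) :=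
  (Submodule.span ℝ
    {b | ∃ f : L2 T₁ T₂, ∃ η ∈ LinearMap.ker 𝒦, b = tensorVec f η}).topologicalClosure

/-! ### Shifts and environments -/

/-- The space `𝒱` of square-integrable `L²([T₁, T₂])ⁿ`-valued random elements on `(Ω, P)`, with
`‖A‖² = E ‖A‖²_{L²([T₁, T₂])ⁿ}`. -/
abbrev Shift (n : ℕ) (T₁ T₂ : ℝ) {Ω : Type u} [MeasurableSpace Ω] (P : Measure Ω) :=
  Lp (L2Vec n T₁ T₂) 2 P

/-- The shift set `C^γ_𝒜(A)`: the shifts `A' ∈ 𝒜` whose covariance kernel is dominated, as a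
quadratic form on `L²([T₁, T₂])ⁿ`, by `γ` times that of `A`. -/
def shiftSet {n : ℕ} {Ω : Type u} [MeasurableSpace Ω] {P : Measure Ω}
    (𝒜 : Set (Shift n T₁ T₂ P)) (γ : ℝ) (A : Shift n T₁ T₂ P) : Set (Shift n T₁ T₂ P) :=
  {A' | A' ∈ 𝒜 ∧ ∀ g : L2Vec n T₁ T₂, covForm P A' g ≤ γ * covForm P A g}

/-- An environment with shift `A`: an extension `(space, prob)` of the probability space `(Ω, P)`,
given by a measure preserving projection, that carries a copy `noise` of the noise `ε` which is
independent of (the lift of) `A`. -/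
structure Environment {n : ℕ} {Ω : Type u} [MeasurableSpace Ω] (P : Measure Ω)
    (ε A : Shift n T₁ T₂ P) where
  space : Type v
  [mspace : MeasurableSpace space]
  prob : Measure space
  [isProb : IsProbabilityMeasure prob]
  proj : space → Ω
  proj_mp : MeasurePreserving proj prob P
  noise : space → L2Vec n T₁ T₂
  noise_law : IdentDistrib noise ε prob P
  indep : IndepFun (fun ω => A (proj ω)) noise prob

attribute [instance] Environment.mspace Environment.isProb

namespace Environment

variable {p : ℕ} {Ω : Type u} [MeasurableSpace Ω] {P : Measure Ω} {ε A : Shift (p + 1) T₁ T₂ P}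

/-- The system `(Y^A, X^A) = 𝒮 (A + ε_A)`. -/
def state (E : Environment.{u, v} P ε A) (S : L2Vec (p + 1) T₁ T₂ →L[ℝ] L2Vec (p + 1) T₁ T₂)
    (ω : E.space) : L2Vec (p + 1) T₁ T₂ :=
  S (A (E.proj ω) + E.noise ω)

/-- The target `Y^A`: the first coordinate of the system. -/
def Y (E : Environment.{u, v} P ε A) (S : L2Vec (p + 1) T₁ T₂ →L[ℝ] L2Vec (p + 1) T₁ T₂)
    (ω : E.space) : L2 T₁ T₂ :=
  E.state S ω 0

/-- The covariates `X^A`: the last `p` coordinates of the system. -/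
def X (E : Environment.{u, v} P ε A) (S : L2Vec (p + 1) T₁ T₂ →L[ℝ] L2Vec (p + 1) T₁ T₂)
    (ω : E.space) : L2Vec p T₁ T₂ :=
  WithLp.toLp 2 (fun i : Fin p => E.state S ω i.succ)

/-- The risk `R_A(β) = E_A ∫ (Y^A_t - ∑ᵢ ∫ β(t, τ)(i) X^A_τ(i) dτ)² dt`. -/
def risk (E : Environment.{u, v} P ε A) (S : L2Vec (p + 1) T₁ T₂ →L[ℝ] L2Vec (p + 1) T₁ T₂)
    (β : L2SqVec p T₁ T₂) : ℝ≥0∞ :=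
  ∫⁻ ω, ∫⁻ t, ENNReal.ofReal
      ((E.Y S ω t - ∑ i, ∫ τ, β i (t, τ) * E.X S ω i τ ∂timeMeasure T₁ T₂) ^ 2)
    ∂timeMeasure T₁ T₂ ∂E.prob

/-- The score `Z^A = ∫ Y^A_t φ(t) dt`. -/
def scoreZ (E : Environment.{u, v} P ε A) (S : L2Vec (p + 1) T₁ T₂ →L[ℝ] L2Vec (p + 1) T₁ T₂)
    (φ : L2 T₁ T₂) (ω : E.space) : ℝ :=
  ⟪E.Y S ω, φ⟫_ℝ

/-- The score `χ^A = ∑ᵢ ∫ X^A_t(i) ψ(t)(i) dt`. -/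
def scoreX (E : Environment.{u, v} P ε A) (S : L2Vec (p + 1) T₁ T₂ →L[ℝ] L2Vec (p + 1) T₁ T₂)
    (ψ : L2Vec p T₁ T₂) (ω : E.space) : ℝ :=
  ⟪E.X S ω, ψ⟫_ℝ

end Environment

variable {p : ℕ} {Ω : Type u} [MeasurableSpace Ω] {P : Measure Ω} {ε : Shift (p + 1) T₁ T₂ P}

/-- The worst risk `sup_{A' ∈ C} R_{A'}(β)` over a set `C` of shifts. -/
def worstRisk (E : ∀ A : Shift (p + 1) T₁ T₂ P, Environment.{u, v} P ε A)
    (S : L2Vec (p + 1) T₁ T₂ →L[ℝ] L2Vec (p + 1) T₁ T₂) (C : Set (Shift (p + 1) T₁ T₂ P))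
    (β : L2SqVec p T₁ T₂) : ℝ≥0∞ :=
  ⨆ A' ∈ C, (E A').risk S β

/-- The set `argmin_β sup_{A' ∈ C} R_{A'}(β)` over all `β ∈ L²([T₁, T₂]²)ᵖ`. -/
def minimizers (E : ∀ A : Shift (p + 1) T₁ T₂ P, Environment.{u, v} P ε A)
    (S : L2Vec (p + 1) T₁ T₂ →L[ℝ] L2Vec (p + 1) T₁ T₂) (C : Set (Shift (p + 1) T₁ T₂ P)) :
    Set (L2SqVec p T₁ T₂) :=
  {β | ∀ β', worstRisk E S C β ≤ worstRisk E S C β'}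

/-- The coefficient
`(γ E[Z^A χ^A] + (1 - γ) E[Z^O χ^O]) / (γ E[(χ^A)²] + (1 - γ) E[(χ^O)²])`,
where `O` is the observational environment, whose shift is zero. -/
def coeff (E : ∀ A : Shift (p + 1) T₁ T₂ P, Environment.{u, v} P ε A)
    (S : L2Vec (p + 1) T₁ T₂ →L[ℝ] L2Vec (p + 1) T₁ T₂) (γ : ℝ) (A : Shift (p + 1) T₁ T₂ P)
    (φ : L2 T₁ T₂) (ψ : L2Vec p T₁ T₂) : ℝ :=
  (γ * ∫ ω, (E A).scoreZ S φ ω * (E A).scoreX S ψ ω ∂(E A).prob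
      + (1 - γ) * ∫ ω, (E 0).scoreZ S φ ω * (E 0).scoreX S ψ ω ∂(E 0).prob)
    / (γ * ∫ ω, (E A).scoreX S ψ ω ^ 2 ∂(E A).prob
      + (1 - γ) * ∫ ω, (E 0).scoreX S ψ ω ^ 2 ∂(E 0).prob)

end FunctionalSEM

end

open FunctionalSEM

/-!
Write `(Y, X)` for the system in the environment with shift `√γ A`. The proof has two halves.

**The worst risk is the risk at `√γ A`.** The residual `Y - ∫ β X` is a bounded linear map `M` of
`A' + ε`. As the noise is centred and independent of `A'`, second moments split
(`Environment.integral_bilin_state`), so `R_{A'}(β) = E‖M A'‖² + E‖M ε‖²`. By Parseval,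
`E‖M A'‖² = ∑ₖ E⟨A', M* φₖ⟩²`, a sum of values of the covariance form of `A'`; hence it is at most
`γ E‖M A‖² = E‖M (√γ A)‖²` for every shift in `C^γ_𝒜(A)`. The risk is continuous in the shift and
`√γ A` is a limit of such shifts, so the bound is the supremum (`worstRisk_eq_risk`). The same
splitting turns the coefficients `c_{k,l}` into `E[⟨Y, φₖ⟩⟨X, ψₗ⟩] / E[⟨X, ψₗ⟩²]` (`coeff_eq`).

**Least squares for one system.** The operator with kernel `β` satisfies
`⟨∫ β x, f⟩ = ⟨β, f ⊗ x⟩`, so the normal equations for `β₀` say that the single vector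
`E[(Y - ∫ β₀ X) ⊗ X]` of `L²([T₁, T₂]²)ᵖ` vanishes. Tensors are total there
(`eq_zero_of_inner_tensorVec`), so it is enough to test against `f ⊗ g` with `g ∈ Ker 𝒦`, where
`⟨X, g⟩ = 0` almost surely, and against `φₖ ⊗ ψₗ`, where the equation is the formula for `c_{k,l}`
(`integral_tensorVec_residual_eq_zero`). Then `R(β₀ + b) = R(β₀) + E‖∫ b X‖²`
(`integral_norm_residual_sq_add`), and the last term vanishes exactly when all partial pairings
`∫ b(t, ·) f(t) dt` lie in `Ker 𝒦`, that is, when `b ∈ W`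
(`integral_norm_regOp_sq_eq_zero_iff`, `mem_nullSpace_iff`).
-/

open FunctionalSEM

namespace FunctionalSEM

universe u v

variable {T₁ T₂ : ℝ}

/-! ### Tensor products -/

theorem coeFn_tensor (f g : L2 T₁ T₂) :
    tensor f g =ᵐ[(timeMeasure T₁ T₂).prod (timeMeasure T₁ T₂)] fun z => f z.1 * g z.2 :=
  (memLp_tensor f g).coeFn_toLp

theorem inner_tensor_right (k : L2Sq T₁ T₂) (f g : L2 T₁ T₂) :
    ⟪k, tensor f g⟫_ℝ = ∫ z : ℝ × ℝ, k z * (f z.1 * g z.2)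
      ∂((timeMeasure T₁ T₂).prod (timeMeasure T₁ T₂)) := by
  rw [L2.inner_def]
  refine integral_congr_ae ?_
  filter_upwards [coeFn_tensor f g] with z hz
  rw [hz, real_inner_eq_re_inner, RCLike.inner_apply]
  simp [mul_comm]

theorem inner_tensor_tensor (f g f' g' : L2 T₁ T₂) :
    ⟪tensor f g, tensor f' g'⟫_ℝ = ⟪f, f'⟫_ℝ * ⟪g, g'⟫_ℝ := by
  rw [inner_tensor_right, L2.inner_def, L2.inner_def, ← integral_prod_mul]
  refine integral_congr_ae ?_
  filter_upwards [coeFn_tensor f g] with z hz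
  rw [hz]
  simp
  ring

/-- `tensor` as a bilinear map. -/
noncomputable def tensorₗ : L2 T₁ T₂ →ₗ[ℝ] L2 T₁ T₂ →ₗ[ℝ] L2Sq T₁ T₂ :=
  LinearMap.mk₂ ℝ tensor
    (fun f f' g => by
      refine Lp.ext ?_
      filter_upwards [coeFn_tensor (f + f') g, coeFn_tensor f g, coeFn_tensor f' g,
        Lp.coeFn_add (tensor f g) (tensor f' g),
        Measure.quasiMeasurePreserving_fst.ae_eq_comp (Lp.coeFn_add f f')] with z h1 h2 h3 h4 h5
      simp only [Function.comp_apply, Pi.add_apply] at h4 h5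
      rw [h1, h4, h2, h3, h5, add_mul])
    (fun c f g => by
      refine Lp.ext ?_
      filter_upwards [coeFn_tensor (c • f) g, coeFn_tensor f g,
        Lp.coeFn_smul c (tensor f g),
        Measure.quasiMeasurePreserving_fst.ae_eq_comp (Lp.coeFn_smul c f)] with z h1 h2 h4 h5
      simp only [Function.comp_apply, Pi.smul_apply, smul_eq_mul] at h4 h5
      rw [h1, h4, h2, h5, mul_assoc])
    (fun f g g' => by
      refine Lp.ext ?_
      filter_upwards [coeFn_tensor f (g + g'), coeFn_tensor f g, coeFn_tensor f g',
        Lp.coeFn_add (tensor f g) (tensor f g'),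
        Measure.quasiMeasurePreserving_snd.ae_eq_comp (Lp.coeFn_add g g')] with z h1 h2 h3 h4 h5
      simp only [Function.comp_apply, Pi.add_apply] at h4 h5
      rw [h1, h4, h2, h3, h5, mul_add])
    (fun c f g => by
      refine Lp.ext ?_
      filter_upwards [coeFn_tensor f (c • g), coeFn_tensor f g,
        Lp.coeFn_smul c (tensor f g),
        Measure.quasiMeasurePreserving_snd.ae_eq_comp (Lp.coeFn_smul c g)] with z h1 h2 h4 h5
      simp only [Function.comp_apply, Pi.smul_apply, smul_eq_mul] at h4 h5
      rw [h1, h4, h2, h5]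
      ring)

theorem norm_tensor (f g : L2 T₁ T₂) : ‖tensor f g‖ = ‖f‖ * ‖g‖ := by
  rw [← sq_eq_sq₀ (norm_nonneg _) (by positivity), ← real_inner_self_eq_norm_sq,
    inner_tensor_tensor, real_inner_self_eq_norm_sq, real_inner_self_eq_norm_sq, mul_pow]

theorem tensorVec_add_left {n : ℕ} (f f' : L2 T₁ T₂) (g : L2Vec n T₁ T₂) :
    tensorVec (f + f') g = tensorVec f g + tensorVec f' g := by
  ext1 i
  exact tensorₗ.map_add₂ f f' (g i)

theorem tensorVec_smul_left {n : ℕ} (c : ℝ) (f : L2 T₁ T₂) (g : L2Vec n T₁ T₂) :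
    tensorVec (c • f) g = c • tensorVec f g := by
  ext1 i
  exact tensorₗ.map_smul₂ c f (g i)

theorem tensorVec_add_right {n : ℕ} (f : L2 T₁ T₂) (g g' : L2Vec n T₁ T₂) :
    tensorVec f (g + g') = tensorVec f g + tensorVec f g' := by
  ext1 i
  exact (tensorₗ f).map_add (g i) (g' i)

theorem tensorVec_smul_right {n : ℕ} (c : ℝ) (f : L2 T₁ T₂) (g : L2Vec n T₁ T₂) :
    tensorVec f (c • g) = c • tensorVec f g := by
  ext1 i
  exact (tensorₗ f).map_smul c (g i)

theorem inner_tensorVec_right {n : ℕ} (β : L2SqVec n T₁ T₂) (f : L2 T₁ T₂) (g : L2Vec n T₁ T₂) :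
    ⟪β, tensorVec f g⟫_ℝ = ∑ i, ⟪β i, tensor f (g i)⟫_ℝ := by
  rw [PiLp.inner_apply]
  rfl

theorem inner_tensorVec_tensorVec {n : ℕ} (f f' : L2 T₁ T₂) (g g' : L2Vec n T₁ T₂) :
    ⟪tensorVec f g, tensorVec f' g'⟫_ℝ = ⟪f, f'⟫_ℝ * ⟪g, g'⟫_ℝ := by
  rw [inner_tensorVec_right, PiLp.inner_apply, Finset.mul_sum]
  exact Finset.sum_congr rfl fun i _ => inner_tensor_tensor _ _ _ _

theorem norm_tensorVec {n : ℕ} (f : L2 T₁ T₂) (g : L2Vec n T₁ T₂) :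
    ‖tensorVec f g‖ = ‖f‖ * ‖g‖ := by
  rw [← sq_eq_sq₀ (norm_nonneg _) (by positivity), ← real_inner_self_eq_norm_sq,
    inner_tensorVec_tensorVec, real_inner_self_eq_norm_sq, real_inner_self_eq_norm_sq, mul_pow]

/-- `tensorVec` as a continuous bilinear map. -/
noncomputable def tensorVecL (n : ℕ) : L2 T₁ T₂ →L[ℝ] L2Vec n T₁ T₂ →L[ℝ] L2SqVec n T₁ T₂ :=
  LinearMap.mkContinuous₂
    (LinearMap.mk₂ ℝ tensorVec tensorVec_add_left tensorVec_smul_left tensorVec_add_right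
      tensorVec_smul_right) 1 fun f g => by
    rw [one_mul]; exact (norm_tensorVec f g).le

theorem tensorVecL_apply {n : ℕ} (f : L2 T₁ T₂) (g : L2Vec n T₁ T₂) :
    tensorVecL n f g = tensorVec f g := rfl

/-- `tensor` as a continuous bilinear map. -/
noncomputable def tensorL : L2 T₁ T₂ →L[ℝ] L2 T₁ T₂ →L[ℝ] L2Sq T₁ T₂ :=
  LinearMap.mkContinuous₂ tensorₗ 1 fun f g => by
    rw [one_mul]; exact (norm_tensor f g).le

/-- The simple tensors are total in `L²([T₁, T₂]²)`: testing against indicators shows that `k`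
integrates to zero over every measurable rectangle, hence over every measurable set. -/
theorem eq_zero_of_inner_tensor {k : L2Sq T₁ T₂} (h : ∀ f g, ⟪k, tensor f g⟫_ℝ = 0) : k = 0 := by
  have hk : Integrable k ((timeMeasure T₁ T₂).prod (timeMeasure T₁ T₂)) :=
    (Lp.memLp k).integrable (by norm_num)
  -- An indicator of a rectangle is the tensor product of two indicators.
  have hrect : ∀ s t : Set ℝ, MeasurableSet s → MeasurableSet t →
      ∫ z in s ×ˢ t, k z ∂((timeMeasure T₁ T₂).prod (timeMeasure T₁ T₂)) = 0 := by
    intro s t hs ht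
    have h1 := h (indicatorConstLp 2 hs (measure_ne_top _ _) (1 : ℝ))
      (indicatorConstLp 2 ht (measure_ne_top _ _) (1 : ℝ))
    rw [inner_tensor_right] at h1
    rw [← h1, ← integral_indicator (hs.prod ht)]
    refine integral_congr_ae ?_
    filter_upwards [Measure.quasiMeasurePreserving_fst.ae_eq_comp
        (indicatorConstLp_coeFn (p := 2) (μ := timeMeasure T₁ T₂) (hs := hs)
          (hμs := measure_ne_top _ _) (c := (1 : ℝ))),
      Measure.quasiMeasurePreserving_snd.ae_eq_comp
        (indicatorConstLp_coeFn (p := 2) (μ := timeMeasure T₁ T₂) (hs := ht)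
          (hμs := measure_ne_top _ _) (c := (1 : ℝ)))] with z h2 h3
    simp only [Function.comp_apply] at h2 h3
    rw [h2, h3]
    by_cases hz1 : z.1 ∈ s <;> by_cases hz2 : z.2 ∈ t <;> simp [Set.indicator, hz1, hz2]
  refine (Lp.eq_zero_iff_ae_eq_zero).2 ?_
  refine hk.ae_eq_zero_of_forall_setIntegral_eq_zero fun s hs _ => ?_
  refine MeasurableSpace.induction_on_inter
    (C := fun s _ => ∫ z in s, k z ∂((timeMeasure T₁ T₂).prod (timeMeasure T₁ T₂)) = 0)
    generateFrom_prod.symm isPiSystem_prod (by simp) ?_ ?_ ?_ s hs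
  · rintro _ ⟨s, hs, t, ht, rfl⟩
    exact hrect s t hs ht
  · intro t ht h0
    have := integral_add_compl ht hk
    have hu := hrect Set.univ Set.univ .univ .univ
    rw [Set.univ_prod_univ, setIntegral_univ] at hu
    linarith
  · intro f hd hm h0
    rw [integral_iUnion hm hd hk.integrableOn]
    simp [h0]

theorem eq_zero_of_inner_tensorVec {n : ℕ} {b : L2SqVec n T₁ T₂}
    (h : ∀ f g, ⟪b, tensorVec f g⟫_ℝ = 0) : b = 0 := by
  ext1 i
  refine eq_zero_of_inner_tensor fun f g => ?_
  have := h f (WithLp.toLp 2 (Pi.single i g))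
  rw [inner_tensorVec_right, Finset.sum_eq_single i] at this
  · simpa using this
  · intro j _ hj
    have : tensor f (0 : L2 T₁ T₂) = 0 := (tensorₗ f).map_zero
    simp [hj, this]
  · simp

/-! ### Integral operators through the tensor pairing -/

/-- Fubini: the operator with kernel `k` represents the bilinear form `(f, g) ↦ ⟨k, f ⊗ g⟩`. -/
theorem inner_kernelOp (k : L2Sq T₁ T₂) (f g : L2 T₁ T₂) :
    ⟪kernelOp k f, g⟫_ℝ = ⟪k, tensor f g⟫_ℝ := by
  rw [inner_tensor_right, L2.inner_def]
  have hi : Integrable (fun z : ℝ × ℝ => k z * (f z.1 * g z.2))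
      ((timeMeasure T₁ T₂).prod (timeMeasure T₁ T₂)) :=
    MemLp.integrable_mul (Lp.memLp k) (memLp_tensor f g)
  rw [integral_prod_symm _ hi]
  refine integral_congr_ae ?_
  have : kernelOp k f =ᵐ[timeMeasure T₁ T₂] fun t => ∫ s, k (s, t) * f s ∂timeMeasure T₁ T₂ :=
    (memLp_kernelOp k f).coeFn_toLp
  filter_upwards [this] with t ht
  rw [ht]
  simp only [← mul_assoc, integral_mul_const]
  simp [mul_comm]

/-- The transposed kernel `(s, t) ↦ k(t, s)`. -/
noncomputable def swapKernel (k : L2Sq T₁ T₂) : L2Sq T₁ T₂ :=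
  Lp.compMeasurePreserving Prod.swap Measure.measurePreserving_swap k

theorem coeFn_swapKernel (k : L2Sq T₁ T₂) :
    swapKernel k =ᵐ[(timeMeasure T₁ T₂).prod (timeMeasure T₁ T₂)] fun z => k z.swap :=
  Lp.coeFn_compMeasurePreserving k Measure.measurePreserving_swap

theorem inner_swapKernel (k : L2Sq T₁ T₂) (f g : L2 T₁ T₂) :
    ⟪swapKernel k, tensor f g⟫_ℝ = ⟪k, tensor g f⟫_ℝ := by
  rw [inner_tensor_right, inner_tensor_right, ← integral_prod_swap]
  refine integral_congr_ae ?_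
  have := (Measure.measurePreserving_swap (μ := timeMeasure T₁ T₂)
    (ν := timeMeasure T₁ T₂)).quasiMeasurePreserving.ae_eq_comp (coeFn_swapKernel k)
  filter_upwards [this] with z hz
  simp only [Function.comp_apply, Prod.swap_swap] at hz
  simp only [hz, Prod.fst_swap, Prod.snd_swap]
  ring

/-- The function-on-function regression operator `x ↦ (t ↦ ∑ᵢ ∫ βᵢ(t, τ) xᵢ(τ) dτ)` with kernel `β`,
as a linear map. The kernels are swapped because `kernelOp` integrates over the first variable. -/
noncomputable def regOpₗ {n : ℕ} (β : L2SqVec n T₁ T₂) : L2Vec n T₁ T₂ →ₗ[ℝ] L2 T₁ T₂ where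
  toFun x := ∑ i, kernelOp (swapKernel (β i)) (x i)
  map_add' x y := by simp [Finset.sum_add_distrib]
  map_smul' c x := by simp [Finset.smul_sum]

theorem inner_regOpₗ {n : ℕ} (β : L2SqVec n T₁ T₂) (x : L2Vec n T₁ T₂) (f : L2 T₁ T₂) :
    ⟪regOpₗ β x, f⟫_ℝ = ⟪β, tensorVec f x⟫_ℝ := by
  change ⟪∑ i, kernelOp (swapKernel (β i)) (x i), f⟫_ℝ = _
  rw [sum_inner, inner_tensorVec_right]
  simp only [inner_kernelOp, inner_swapKernel]

theorem norm_regOpₗ_le {n : ℕ} (β : L2SqVec n T₁ T₂) (x : L2Vec n T₁ T₂) :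
    ‖regOpₗ β x‖ ≤ ‖β‖ * ‖x‖ := by
  have h : ‖regOpₗ β x‖ ^ 2 ≤ ‖β‖ * (‖regOpₗ β x‖ * ‖x‖) := by
    rw [← real_inner_self_eq_norm_sq, inner_regOpₗ, ← norm_tensorVec]
    exact real_inner_le_norm _ _
  -- The inequality can be divided by `‖regOpₗ β x‖` unless that norm is zero.
  rcases (norm_nonneg (regOpₗ β x)).eq_or_lt with h0 | h0
  · rw [← h0]; positivity
  · exact le_of_mul_le_mul_left (by linarith) h0

/-- The regression operator `regOpₗ β` as a bounded operator. -/
noncomputable def regOp {n : ℕ} (β : L2SqVec n T₁ T₂) : L2Vec n T₁ T₂ →L[ℝ] L2 T₁ T₂ :=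
  (regOpₗ β).mkContinuous ‖β‖ (norm_regOpₗ_le β)

theorem regOp_apply {n : ℕ} (β : L2SqVec n T₁ T₂) (x : L2Vec n T₁ T₂) :
    regOp β x = ∑ i, kernelOp (swapKernel (β i)) (x i) := rfl

theorem inner_regOp {n : ℕ} (β : L2SqVec n T₁ T₂) (x : L2Vec n T₁ T₂) (f : L2 T₁ T₂) :
    ⟪regOp β x, f⟫_ℝ = ⟪β, tensorVec f x⟫_ℝ :=
  inner_regOpₗ β x f

theorem regOp_add {n : ℕ} (β b : L2SqVec n T₁ T₂) : regOp (β + b) = regOp β + regOp b := by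
  ext1 x
  refine ext_inner_right ℝ fun f => ?_
  rw [add_apply, inner_add_left, inner_regOp, inner_regOp, inner_regOp,
    inner_add_left]

/-- `regOp β x` is the regression function in the definition of the risk. -/
theorem coeFn_regOp {n : ℕ} (β : L2SqVec n T₁ T₂) (x : L2Vec n T₁ T₂) :
    regOp β x =ᵐ[timeMeasure T₁ T₂]
      fun t => ∑ i, ∫ τ, β i (t, τ) * x i τ ∂timeMeasure T₁ T₂ := by
  have h : ∀ i, kernelOp (swapKernel (β i)) (x i) =ᵐ[timeMeasure T₁ T₂]
      fun t => ∫ τ, β i (t, τ) * x i τ ∂timeMeasure T₁ T₂ := by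
    intro i
    refine ((memLp_kernelOp (swapKernel (β i)) (x i)).coeFn_toLp).trans ?_
    have := (Measure.measurePreserving_swap (μ := timeMeasure T₁ T₂)
      (ν := timeMeasure T₁ T₂)).quasiMeasurePreserving.ae_eq_comp (coeFn_swapKernel (β i))
    filter_upwards [Measure.ae_ae_of_ae_prod this] with t ht
    refine integral_congr_ae ?_
    filter_upwards [ht] with s hs
    simp only [Function.comp_apply, Prod.swap_prod_mk] at hs
    rw [hs]
  rw [regOp_apply]
  filter_upwards [Lp.coeFn_finsetSum Finset.univ fun i => kernelOp (swapKernel (β i)) (x i),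
    ae_all_iff.2 h] with t h3 h4
  rw [h3, Finset.sum_apply]
  exact Finset.sum_congr rfl fun i _ => h4 i

/-! ### Covariance kernels and operators -/

section Covariance

variable {n : ℕ} {Ω : Type*} [MeasurableSpace Ω] {P : Measure Ω} {U : Ω → L2Vec n T₁ T₂}

theorem memLp_coord (hU : MemLp U 2 P) (i : Fin n) : MemLp (fun ω => U ω i) 2 P :=
  (PiLp.proj 2 (𝕜 := ℝ) (fun _ : Fin n => L2 T₁ T₂) i).comp_memLp' hU

theorem integrable_inner_mul_inner {G : Type*} [NormedAddCommGroup G] [InnerProductSpace ℝ G]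
    {G' : Type*} [NormedAddCommGroup G'] [InnerProductSpace ℝ G']
    {V : Ω → G} {V' : Ω → G'} (hV : MemLp V 2 P) (hV' : MemLp V' 2 P) (g : G) (h : G') :
    Integrable (fun ω => ⟪V ω, g⟫_ℝ * ⟪V' ω, h⟫_ℝ) P :=
  MemLp.integrable_mul (hV.inner_const g) (hV'.inner_const h)

theorem inner_covKernel (hU : MemLp U 2 P) (i j : Fin n) (f g : L2 T₁ T₂) :
    ⟪covKernel P U i j, tensor f g⟫_ℝ = ∫ ω, ⟪U ω i, f⟫_ℝ * ⟪U ω j, g⟫_ℝ ∂P := by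
  have hi : Integrable (fun ω => tensor (U ω i) (U ω j)) P :=
    memLp_one_iff_integrable.1 (tensorL.memLp_of_bilin 1 (memLp_coord hU i) (memLp_coord hU j))
  rw [real_inner_comm, covKernel, ← integral_inner hi]
  simp only [inner_tensor_tensor, real_inner_comm]

theorem sum_inner_covKernel (hU : MemLp U 2 P) (g h : L2Vec n T₁ T₂) :
    ∑ i, ∑ j, ⟪covKernel P U i j, tensor (g i) (h j)⟫_ℝ = ∫ ω, ⟪U ω, g⟫_ℝ * ⟪U ω, h⟫_ℝ ∂P := by
  have hi : ∀ i j, Integrable (fun ω => ⟪U ω i, g i⟫_ℝ * ⟪U ω j, h j⟫_ℝ) P := fun i j =>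
    integrable_inner_mul_inner (memLp_coord hU i) (memLp_coord hU j) _ _
  simp only [inner_covKernel hU, PiLp.inner_apply, Finset.sum_mul_sum]
  rw [integral_finsetSum _ fun i _ => integrable_finsetSum _ fun j _ => hi i j]
  exact Finset.sum_congr rfl fun i _ => (integral_finsetSum _ fun j _ => hi i j).symm

theorem inner_covOp (hU : MemLp U 2 P) (g h : L2Vec n T₁ T₂) :
    ⟪covOp P U g, h⟫_ℝ = ∫ ω, ⟪U ω, g⟫_ℝ * ⟪U ω, h⟫_ℝ ∂P := by
  rw [← sum_inner_covKernel hU, Finset.sum_comm, PiLp.inner_apply]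
  refine Finset.sum_congr rfl fun j _ => ?_
  change ⟪∑ i, kernelOp (covKernel P U i j) (g i), h j⟫_ℝ = _
  rw [sum_inner]
  exact Finset.sum_congr rfl fun i _ => inner_kernelOp _ _ _

theorem covForm_eq (hU : MemLp U 2 P) (g : L2Vec n T₁ T₂) :
    covForm P U g = ∫ ω, ⟪U ω, g⟫_ℝ ^ 2 ∂P := by
  have hi : ∀ i j, Integrable (fun z : ℝ × ℝ => g i z.1 * covKernel P U i j z * g j z.2)
      ((timeMeasure T₁ T₂).prod (timeMeasure T₁ T₂)) := fun i j => by
    refine (MemLp.integrable_mul (Lp.memLp (covKernel P U i j))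
      (memLp_tensor (g i) (g j))).congr (Filter.Eventually.of_forall fun z => ?_)
    simp only [Pi.mul_apply]
    ring
  simp only [sq]
  rw [← sum_inner_covKernel hU, covForm,
    integral_finsetSum _ fun i _ => integrable_finsetSum _ fun j _ => hi i j]
  refine Finset.sum_congr rfl fun i _ => ?_
  rw [integral_finsetSum _ fun j _ => hi i j]
  refine Finset.sum_congr rfl fun j _ => ?_
  rw [inner_tensor_right]
  congr 1 with z
  ring

/-- `𝒦 g = 0` exactly when `⟨U, g⟩ = 0` almost surely. -/
theorem covOp_eq_zero_iff (hU : MemLp U 2 P) (g : L2Vec n T₁ T₂) :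
    covOp P U g = 0 ↔ ∫ ω, ⟪U ω, g⟫_ℝ ^ 2 ∂P = 0 := by
  constructor
  · intro h
    simp only [sq]
    rw [← inner_covOp hU, h, inner_zero_left]
  · intro h
    have h0 : (fun ω => ⟪U ω, g⟫_ℝ) =ᵐ[P] 0 := by
      have := (integral_eq_zero_iff_of_nonneg (fun ω => sq_nonneg ⟪U ω, g⟫_ℝ)
        (hU.inner_const g).integrable_sq).1 h
      filter_upwards [this] with ω hω
      exact pow_eq_zero_iff two_ne_zero |>.1 hω
    refine ext_inner_right ℝ fun k => ?_
    rw [inner_covOp hU, inner_zero_left]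
    refine integral_eq_zero_of_ae ?_
    filter_upwards [h0] with ω hω
    simp [hω]

end Covariance

/-! ### Residuals and second moments in an environment -/

/-- Second moments add over independent summands, one of which is centred. -/
theorem integral_bilin_add_of_indep {H : Type*} [NormedAddCommGroup H] [NormedSpace ℝ H]
    [CompleteSpace H] [MeasurableSpace H] [BorelSpace H]
    {Ω : Type*} [MeasurableSpace Ω] {P : Measure Ω} [IsProbabilityMeasure P]
    {U N : Ω → H} (hU : MemLp U 2 P) (hN : MemLp N 2 P) (hind : IndepFun U N P)
    (hN0 : ∫ ω, N ω ∂P = 0) (B : H →L[ℝ] H →L[ℝ] ℝ) :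
    ∫ ω, B (U ω + N ω) (U ω + N ω) ∂P = ∫ ω, B (U ω) (U ω) ∂P + ∫ ω, B (N ω) (N ω) ∂P := by
  have hint : ∀ {V V' : Ω → H}, MemLp V 2 P → MemLp V' 2 P →
      Integrable (fun ω => B (V ω) (V' ω)) P := fun hV hV' =>
    memLp_one_iff_integrable.1 (B.memLp_of_bilin 1 hV hV')
  have hUi := hU.integrable one_le_two
  have hNi := hN.integrable one_le_two
  have h1 : ∫ ω, B (U ω) (N ω) ∂P = 0 := by
    rw [hind.integral_bilin hUi hNi B, hN0, map_zero]
  have h2 : ∫ ω, B (N ω) (U ω) ∂P = 0 := by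
    rw [hind.symm.integral_bilin hNi hUi B, hN0, map_zero, zero_apply]
  simp only [map_add, add_apply]
  have h3 : Integrable (fun ω => B (U ω) (U ω) + B (N ω) (U ω)) P := (hint hU hU).add (hint hN hU)
  have h4 : Integrable (fun ω => B (U ω) (N ω) + B (N ω) (N ω)) P := (hint hU hN).add (hint hN hN)
  rw [integral_add h3 h4,
    integral_add (hint hU hU) (hint hN hU), integral_add (hint hU hN) (hint hN hN), h1, h2]
  ring

variable {p : ℕ}

/-- The target coordinate `(y, x) ↦ y` of the system. -/
noncomputable def targetL (p : ℕ) (T₁ T₂ : ℝ) : L2Vec (p + 1) T₁ T₂ →L[ℝ] L2 T₁ T₂ :=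
  PiLp.proj 2 (fun _ : Fin (p + 1) => L2 T₁ T₂) 0

/-- The covariate coordinates `(y, x) ↦ x` of the system. -/
noncomputable def covariatesL (p : ℕ) (T₁ T₂ : ℝ) : L2Vec (p + 1) T₁ T₂ →L[ℝ] L2Vec p T₁ T₂ :=
  (PiLp.continuousLinearEquiv 2 ℝ (fun _ : Fin p => L2 T₁ T₂)).symm.toContinuousLinearMap ∘L
    ContinuousLinearMap.pi fun i : Fin p => PiLp.proj 2 (fun _ : Fin (p + 1) => L2 T₁ T₂) i.succ

/-- The residual map `(y, x) ↦ y - ∑ᵢ ∫ βᵢ(·, τ) xᵢ(τ) dτ`. -/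
noncomputable def residual (β : L2SqVec p T₁ T₂) : L2Vec (p + 1) T₁ T₂ →L[ℝ] L2 T₁ T₂ :=
  targetL p T₁ T₂ - regOp β ∘L covariatesL p T₁ T₂

theorem lintegral_ofReal_sq (h : L2 T₁ T₂) :
    ∫⁻ t, ENNReal.ofReal (h t ^ 2) ∂timeMeasure T₁ T₂ = ENNReal.ofReal (‖h‖ ^ 2) := by
  rw [← real_inner_self_eq_norm_sq, L2.inner_def, ← ofReal_integral_eq_lintegral_ofReal
    (Lp.memLp h).integrable_sq (Filter.Eventually.of_forall fun _ => sq_nonneg _)]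
  congr 2 with t
  simp [sq]

namespace Environment

variable {Ω : Type u} [MeasurableSpace Ω] {P : Measure Ω} {ε A : Shift (p + 1) T₁ T₂ P}
  (E : Environment.{u, v} P ε A) (S : L2Vec (p + 1) T₁ T₂ →L[ℝ] L2Vec (p + 1) T₁ T₂)

theorem memLp_shift : MemLp (fun ω => A (E.proj ω)) 2 E.prob :=
  (Lp.memLp A).comp_measurePreserving E.proj_mp

theorem memLp_noise : MemLp E.noise 2 E.prob :=
  E.noise_law.memLp_iff.2 (Lp.memLp ε)

theorem memLp_state : MemLp (E.state S) 2 E.prob :=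
  S.comp_memLp' (E.memLp_shift.add E.memLp_noise)

theorem Y_eq (ω : E.space) : E.Y S ω = targetL p T₁ T₂ (E.state S ω) := rfl

theorem X_eq (ω : E.space) : E.X S ω = covariatesL p T₁ T₂ (E.state S ω) := rfl

theorem memLp_Y : MemLp (E.Y S) 2 E.prob :=
  (targetL p T₁ T₂).comp_memLp' (E.memLp_state S)

theorem memLp_X : MemLp (E.X S) 2 E.prob :=
  (covariatesL p T₁ T₂).comp_memLp' (E.memLp_state S)

theorem residual_state (β : L2SqVec p T₁ T₂) (ω : E.space) :
    residual β (E.state S ω) = E.Y S ω - regOp β (E.X S ω) := rfl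

theorem risk_eq_ofReal (β : L2SqVec p T₁ T₂) :
    E.risk S β = ENNReal.ofReal (∫ ω, ‖residual β (E.state S ω)‖ ^ 2 ∂E.prob) := by
  have hi : Integrable (fun ω => ‖residual β (E.state S ω)‖ ^ 2) E.prob :=
    ((residual β).comp_memLp' (E.memLp_state S)).integrable_norm_pow'
  rw [ofReal_integral_eq_lintegral_ofReal hi
    (Filter.Eventually.of_forall fun _ => sq_nonneg _)]
  refine lintegral_congr fun ω => ?_
  rw [← lintegral_ofReal_sq, residual_state]
  refine lintegral_congr_ae ?_
  filter_upwards [Lp.coeFn_sub (E.Y S ω) (regOp β (E.X S ω)), coeFn_regOp β (E.X S ω)]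
    with t h1 h2
  rw [h1, Pi.sub_apply, h2]

theorem integral_comp_proj {F : Ω → ℝ} (hF : AEStronglyMeasurable F P) :
    ∫ ω, F ω ∂P = ∫ ω, F (E.proj ω) ∂E.prob := by
  have h := E.proj_mp.map_eq
  rw [← integral_map E.proj_mp.measurable.aemeasurable (by rwa [h]), h]

/-- In every environment the second moments of the system are the sum of a part due to the shift and
a part due to the noise; the latter does not depend on the environment. -/
theorem integral_bilin_state [IsProbabilityMeasure P] (hε : ∫ ω, ε ω ∂P = 0)
    (B : L2Vec (p + 1) T₁ T₂ →L[ℝ] L2Vec (p + 1) T₁ T₂ →L[ℝ] ℝ) :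
    ∫ ω, B (E.state S ω) (E.state S ω) ∂E.prob =
      ∫ ω, B (S (A ω)) (S (A ω)) ∂P + ∫ ω, B (S (ε ω)) (S (ε ω)) ∂P := by
  have hc : Continuous fun x : L2Vec (p + 1) T₁ T₂ => B (S x) (S x) := by fun_prop
  have h0 : ∫ ω, E.noise ω ∂E.prob = 0 := by rw [E.noise_law.integral_eq, hε]
  have h1 := integral_bilin_add_of_indep E.memLp_shift E.memLp_noise E.indep h0
    (B.bilinearComp S S)
  simp only [ContinuousLinearMap.bilinearComp_apply] at h1
  have h3 : ∫ ω, B (S (E.noise ω)) (S (E.noise ω)) ∂E.prob = ∫ ω, B (S (ε ω)) (S (ε ω)) ∂P :=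
    (E.noise_law.comp hc.measurable).integral_eq
  rw [← h3]
  have h2 : ∫ ω, B (S (A ω)) (S (A ω)) ∂P
      = ∫ ω, B (S (A (E.proj ω))) (S (A (E.proj ω))) ∂E.prob :=
    E.integral_comp_proj (hc.comp_aestronglyMeasurable (Lp.aestronglyMeasurable A))
  rw [h2]
  exact h1

end Environment

/-! ### Parseval's identity for second moments -/

theorem integrable_norm_sq {G : Type*} [NormedAddCommGroup G]
    {Ω : Type*} [MeasurableSpace Ω] {P : Measure Ω} {V : Ω → G} (hV : MemLp V 2 P) :
    Integrable (fun ω => ‖V ω‖ ^ 2) P :=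
  hV.norm.integrable_sq

/-- Parseval's identity, integrated: `E‖V‖² = ∑ₖ E⟨V, φₖ⟩²`. -/
theorem hasSum_integral_inner_sq {G : Type*} [NormedAddCommGroup G] [InnerProductSpace ℝ G]
    (φ : HilbertBasis ℕ ℝ G)
    {Ω : Type*} [MeasurableSpace Ω] {P : Measure Ω} {V : Ω → G} (hV : MemLp V 2 P) :
    HasSum (fun k => ∫ ω, ⟪V ω, φ k⟫_ℝ ^ 2 ∂P) (∫ ω, ‖V ω‖ ^ 2 ∂P) := by
  have hs : ∀ ω, HasSum (fun k => ⟪V ω, φ k⟫_ℝ ^ 2) (‖V ω‖ ^ 2) := fun ω => by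
    have := φ.hasSum_inner_mul_inner (V ω) (V ω)
    rw [real_inner_self_eq_norm_sq] at this
    refine this.congr_fun fun k => ?_
    rw [real_inner_comm (V ω) (φ k), sq]
  refine hasSum_integral_of_dominated_convergence (fun k ω => ⟪V ω, φ k⟫_ℝ ^ 2)
    (fun k => ((hV.inner_const (φ k)).aestronglyMeasurable.pow 2)) ?_ ?_ ?_ ?_
  · exact fun k => Filter.Eventually.of_forall fun ω => by
      rw [Real.norm_of_nonneg (sq_nonneg _)]
  · exact Filter.Eventually.of_forall fun ω => (hs ω).summable
  · simp only [fun ω => (hs ω).tsum_eq]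
    exact integrable_norm_sq hV
  · exact Filter.Eventually.of_forall hs

/-! ### Shifts with dominated covariance -/

section WorstCase

variable {n : ℕ} {Ω : Type*} [MeasurableSpace Ω] {P : Measure Ω}

/-- Domination of the covariance form passes to `E‖M A‖²` for every bounded operator `M`, because the
latter is the sum of the values of the form at the vectors `M* φₖ`. -/
theorem integral_norm_sq_comp_le {G : Type*} [NormedAddCommGroup G] [InnerProductSpace ℝ G]
    [CompleteSpace G] (φ : HilbertBasis ℕ ℝ G) (M : L2Vec n T₁ T₂ →L[ℝ] G) {γ : ℝ}
    {A A' : Shift n T₁ T₂ P} (h : ∀ g, covForm P A' g ≤ γ * covForm P A g) :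
    ∫ ω, ‖M (A' ω)‖ ^ 2 ∂P ≤ γ * ∫ ω, ‖M (A ω)‖ ^ 2 ∂P := by
  have h1 := hasSum_integral_inner_sq φ (M.comp_memLp' (Lp.memLp A'))
  have h2 := (hasSum_integral_inner_sq φ (M.comp_memLp' (Lp.memLp A))).mul_left γ
  refine hasSum_le (fun k => ?_) h1 h2
  have h3 := h (ContinuousLinearMap.adjoint M (φ k))
  rw [covForm_eq (Lp.memLp A'), covForm_eq (Lp.memLp A)] at h3
  simpa only [ContinuousLinearMap.adjoint_inner_right, Function.comp_apply] using h3

theorem continuous_integral_norm_sq_comp {G : Type*} [NormedAddCommGroup G]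
    [InnerProductSpace ℝ G] (M : L2Vec n T₁ T₂ →L[ℝ] G) :
    Continuous fun A : Shift n T₁ T₂ P => ∫ ω, ‖M (A ω)‖ ^ 2 ∂P := by
  have h : ∀ A : Shift n T₁ T₂ P, ∫ ω, ‖M (A ω)‖ ^ 2 ∂P = ‖M.compLpL 2 P A‖ ^ 2 := fun A => by
    rw [← real_inner_self_eq_norm_sq, L2.inner_def]
    refine integral_congr_ae ?_
    filter_upwards [M.coeFn_compLpL A] with ω hω
    rw [hω, real_inner_self_eq_norm_sq]
  simp only [h]
  fun_prop

theorem integral_bilin_sqrt_smul {γ : ℝ} (hγ : 0 ≤ γ) (A : Shift n T₁ T₂ P)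
    (B : L2Vec n T₁ T₂ →L[ℝ] L2Vec n T₁ T₂ →L[ℝ] ℝ) :
    ∫ ω, B ((√γ • A : Shift n T₁ T₂ P) ω) ((√γ • A : Shift n T₁ T₂ P) ω) ∂P
      = γ * ∫ ω, B (A ω) (A ω) ∂P := by
  rw [← integral_const_mul]
  refine integral_congr_ae ?_
  filter_upwards [Lp.coeFn_smul √γ A] with ω hω
  rw [hω, Pi.smul_apply, map_smul, map_smul, smul_apply, smul_smul,
    Real.mul_self_sqrt hγ, smul_eq_mul]

end WorstCase

/-! ### The worst risk and the coefficients -/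

section Environments

variable {p : ℕ} {Ω : Type u} [MeasurableSpace Ω] {P : Measure Ω} [IsProbabilityMeasure P]
  {ε : Shift (p + 1) T₁ T₂ P} (E : ∀ A : Shift (p + 1) T₁ T₂ P, Environment.{u, v} P ε A)
  (S : L2Vec (p + 1) T₁ T₂ →L[ℝ] L2Vec (p + 1) T₁ T₂)

/-- The risk depends on the environment only through the shift. -/
theorem risk_eq (hε : ∫ ω, ε ω ∂P = 0) (β : L2SqVec p T₁ T₂) (A : Shift (p + 1) T₁ T₂ P) :
    (E A).risk S β = ENNReal.ofReal (∫ ω, ‖(residual β ∘L S) (A ω)‖ ^ 2 ∂P +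
      ∫ ω, ‖(residual β ∘L S) (ε ω)‖ ^ 2 ∂P) := by
  have h := (E A).integral_bilin_state S hε ((innerSL ℝ).bilinearComp (residual β) (residual β))
  simp only [ContinuousLinearMap.bilinearComp_apply, innerSL_apply_apply,
    real_inner_self_eq_norm_sq] at h
  rw [Environment.risk_eq_ofReal, h]
  rfl

/-- The supremum of the risk over the shift set is the risk at `√γ A`: domination gives `≤`, and
continuity of the risk in the shift gives `≥` because `√γ A` is in the closure. -/
theorem worstRisk_eq_risk (hε : ∫ ω, ε ω ∂P = 0) (𝒜 : Set (Shift (p + 1) T₁ T₂ P)) {γ : ℝ}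
    (hγ : 0 ≤ γ) {A : Shift (p + 1) T₁ T₂ P} (hA : √γ • A ∈ closure (shiftSet 𝒜 γ A))
    (φ : HilbertBasis ℕ ℝ (L2 T₁ T₂)) (β : L2SqVec p T₁ T₂) :
    worstRisk E S (shiftSet 𝒜 γ A) β = (E (√γ • A)).risk S β := by
  refine le_antisymm (iSup₂_le fun A' hA' => ?_) ?_
  · rw [risk_eq E S hε, risk_eq E S hε]
    refine ENNReal.ofReal_le_ofReal (add_le_add_left ?_ _)
    refine (integral_norm_sq_comp_le φ (residual β ∘L S) hA'.2).trans_eq ?_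
    have := integral_bilin_sqrt_smul hγ A
      ((innerSL ℝ).bilinearComp (residual β ∘L S) (residual β ∘L S))
    simp only [ContinuousLinearMap.bilinearComp_apply, innerSL_apply_apply,
      real_inner_self_eq_norm_sq] at this
    exact this.symm
  · have hc : Continuous fun A' : Shift (p + 1) T₁ T₂ P => (E A').risk S β := by
      simp only [risk_eq E S hε]
      exact ENNReal.continuous_ofReal.comp
        ((continuous_integral_norm_sq_comp _).add continuous_const)
    have hcl : IsClosed {A' : Shift (p + 1) T₁ T₂ P |
        (E A').risk S β ≤ worstRisk E S (shiftSet 𝒜 γ A) β} := isClosed_Iic.preimage hc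
    exact closure_minimal
      (fun A' hA' => le_iSup₂ (f := fun A' _ => (E A').risk S β) A' hA') hcl hA

/-- The mixture of `A` and `O` with weights `γ` and `1 - γ` has the second moments of the environment
with shift `√γ A`: the noise parts add up to a single copy. -/
theorem integral_bilin_mix (hε : ∫ ω, ε ω ∂P = 0) {γ : ℝ} (hγ : 0 ≤ γ)
    (A : Shift (p + 1) T₁ T₂ P)
    (B : L2Vec (p + 1) T₁ T₂ →L[ℝ] L2Vec (p + 1) T₁ T₂ →L[ℝ] ℝ) :
    γ * ∫ ω, B ((E A).state S ω) ((E A).state S ω) ∂(E A).prob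
      + (1 - γ) * ∫ ω, B ((E 0).state S ω) ((E 0).state S ω) ∂(E 0).prob
      = ∫ ω, B ((E (√γ • A)).state S ω) ((E (√γ • A)).state S ω) ∂(E (√γ • A)).prob := by
  have h0 : ∫ ω, B (S ((0 : Shift (p + 1) T₁ T₂ P) ω)) (S ((0 : Shift (p + 1) T₁ T₂ P) ω)) ∂P
      = 0 := by
    refine integral_eq_zero_of_ae ?_
    filter_upwards [Lp.coeFn_zero (L2Vec (p + 1) T₁ T₂) 2 P] with ω hω
    rw [hω]
    simp
  have h1 := integral_bilin_sqrt_smul hγ A (B.bilinearComp S S)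
  simp only [ContinuousLinearMap.bilinearComp_apply] at h1
  rw [Environment.integral_bilin_state _ _ hε, Environment.integral_bilin_state _ _ hε,
    Environment.integral_bilin_state _ _ hε, h0, h1]
  ring

theorem coeff_eq (hε : ∫ ω, ε ω ∂P = 0) {γ : ℝ} (hγ : 0 ≤ γ) (A : Shift (p + 1) T₁ T₂ P)
    (f : L2 T₁ T₂) (g : L2Vec p T₁ T₂) :
    coeff E S γ A f g =
      (∫ ω, ⟪(E (√γ • A)).Y S ω, f⟫_ℝ * ⟪(E (√γ • A)).X S ω, g⟫_ℝ ∂(E (√γ • A)).prob) /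
        ∫ ω, ⟪(E (√γ • A)).X S ω, g⟫_ℝ ^ 2 ∂(E (√γ • A)).prob := by
  have h1 := integral_bilin_mix E S hε hγ A ((ContinuousLinearMap.mul ℝ ℝ).bilinearComp
    (innerSL ℝ f ∘L targetL p T₁ T₂) (innerSL ℝ g ∘L covariatesL p T₁ T₂))
  have h2 := integral_bilin_mix E S hε hγ A ((ContinuousLinearMap.mul ℝ ℝ).bilinearComp
    (innerSL ℝ g ∘L covariatesL p T₁ T₂) (innerSL ℝ g ∘L covariatesL p T₁ T₂))
  simp only [ContinuousLinearMap.bilinearComp_apply, ContinuousLinearMap.comp_apply,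
    innerSL_apply_apply, ContinuousLinearMap.mul_apply', ← Environment.X_eq,
    ← Environment.Y_eq, real_inner_comm _ f, real_inner_comm _ g, ← sq] at h1 h2
  rw [coeff, ← h1, ← h2]
  rfl

end Environments

/-! ### Least squares for a single system -/

section Optimization

variable {n : ℕ} {ι : Type*} {Ω : Type*} [MeasurableSpace Ω] {P : Measure Ω}
  {Y : Ω → L2 T₁ T₂} {X : Ω → L2Vec n T₁ T₂} {ψ : ι → L2Vec n T₁ T₂}

/-- The partial pairing `τ ↦ ∫ b(t, τ) f(t) dt`, defined as the adjoint of `g ↦ f ⊗ g`. -/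
noncomputable def slice (f : L2 T₁ T₂) : L2SqVec n T₁ T₂ →L[ℝ] L2Vec n T₁ T₂ :=
  ContinuousLinearMap.adjoint (tensorVecL n f)

theorem inner_slice (f : L2 T₁ T₂) (b : L2SqVec n T₁ T₂) (g : L2Vec n T₁ T₂) :
    ⟪g, slice f b⟫_ℝ = ⟪b, tensorVec f g⟫_ℝ := by
  rw [slice, ContinuousLinearMap.adjoint_inner_right, real_inner_comm, tensorVecL_apply]

theorem inner_regOp_eq_slice (b : L2SqVec n T₁ T₂) (x : L2Vec n T₁ T₂) (f : L2 T₁ T₂) :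
    ⟪regOp b x, f⟫_ℝ = ⟪x, slice f b⟫_ℝ := by
  rw [inner_regOp, inner_slice]

/-- A kernel lies in `W` exactly when all its partial pairings lie in `Ker 𝒦`. For the converse, the
component `z` of `b` orthogonal to `W` also has this property, so it is orthogonal to
`f ⊗ slice f z`, which means `slice f z = 0`. -/
theorem mem_nullSpace_iff {𝒦 : L2Vec n T₁ T₂ →ₗ[ℝ] L2Vec n T₁ T₂}
    (hcl : IsClosed (LinearMap.ker 𝒦 : Set (L2Vec n T₁ T₂))) (b : L2SqVec n T₁ T₂) :
    b ∈ nullSpace 𝒦 ↔ ∀ f, slice f b ∈ LinearMap.ker 𝒦 := by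
  have key : ∀ b ∈ nullSpace 𝒦, ∀ f, slice f b ∈ LinearMap.ker 𝒦 := by
    intro b hb f
    have hc : IsClosed ((LinearMap.ker 𝒦).comap (slice (n := n) f).toLinearMap :
        Set (L2SqVec n T₁ T₂)) := hcl.preimage (slice f).continuous
    refine Submodule.topologicalClosure_minimal _ (Submodule.span_le.2 ?_) hc hb
    rintro _ ⟨f', η, hη, rfl⟩
    have : slice f (tensorVec f' η) = ⟪f', f⟫_ℝ • η := by
      refine ext_inner_left ℝ fun g => ?_
      rw [inner_slice, inner_tensorVec_tensorVec, inner_smul_right, real_inner_comm g η]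
    change slice f (tensorVec f' η) ∈ LinearMap.ker 𝒦
    rw [this]
    exact Submodule.smul_mem _ _ hη
  refine ⟨key b, fun hb => ?_⟩
  have : CompleteSpace (nullSpace 𝒦) :=
    (Submodule.isClosed_topologicalClosure _).completeSpace_coe
  obtain ⟨w, hw, z, hz, rfl⟩ := (nullSpace 𝒦).exists_add_mem_mem_orthogonal b
  have hz0 : z = 0 := by
    have hzk : ∀ f, slice f z ∈ LinearMap.ker 𝒦 := fun f => by
      have := Submodule.sub_mem _ (hb f) (key w hw f)
      rwa [map_add, add_sub_cancel_left] at this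
    refine eq_zero_of_inner_tensorVec fun f g => ?_
    have h0 : slice f z = 0 := by
      rw [← inner_self_eq_zero (𝕜 := ℝ), inner_slice, real_inner_comm]
      exact hz _ (Submodule.le_topologicalClosure _ (Submodule.subset_span ⟨f, _, hzk f, rfl⟩))
    rw [← inner_slice, h0, inner_zero_right]
  rw [hz0, add_zero]
  exact hw

theorem IsEigenfamily.isClosed_ker {𝒦 : L2Vec n T₁ T₂ →ₗ[ℝ] L2Vec n T₁ T₂}
    (hψ : IsEigenfamily 𝒦 ψ) : IsClosed (LinearMap.ker 𝒦 : Set (L2Vec n T₁ T₂)) := by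
  rw [← hψ.exhaust]
  exact Submodule.isClosed_orthogonal _

theorem memLp_regOp (hX : MemLp X 2 P) (b : L2SqVec n T₁ T₂) :
    MemLp (fun ω => regOp b (X ω)) 2 P :=
  (regOp b).comp_memLp' hX

/-- The kernels whose prediction vanishes almost surely are those in `W`. -/
theorem integral_norm_regOp_sq_eq_zero_iff (hX : MemLp X 2 P) (φ : HilbertBasis ℕ ℝ (L2 T₁ T₂))
    (hcl : IsClosed (LinearMap.ker (covOp P X) : Set (L2Vec n T₁ T₂))) (b : L2SqVec n T₁ T₂) :
    ∫ ω, ‖regOp b (X ω)‖ ^ 2 ∂P = 0 ↔ b ∈ nullSpace (covOp P X) := by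
  rw [mem_nullSpace_iff hcl]
  simp only [LinearMap.mem_ker, covOp_eq_zero_iff hX, ← inner_regOp_eq_slice]
  constructor
  · intro h f
    have h0 := (integral_eq_zero_iff_of_nonneg (fun ω => sq_nonneg ‖regOp b (X ω)‖)
        (integrable_norm_sq (memLp_regOp hX b))).1 h
    refine integral_eq_zero_of_ae ?_
    filter_upwards [h0] with ω hω
    have : regOp b (X ω) = 0 := norm_eq_zero.1 (pow_eq_zero_iff two_ne_zero |>.1 hω)
    simp [this]
  · intro h
    have := hasSum_integral_inner_sq φ (memLp_regOp hX b)
    simp only [h] at this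
    exact this.unique hasSum_zero

theorem integrable_tensorVec {V : Ω → L2 T₁ T₂} (hV : MemLp V 2 P) (hX : MemLp X 2 P) :
    Integrable (fun ω => tensorVec (V ω) (X ω)) P :=
  memLp_one_iff_integrable.1 ((tensorVecL n).memLp_of_bilin 1 hV hX)

theorem inner_integral_tensorVec {V : Ω → L2 T₁ T₂} (hV : MemLp V 2 P) (hX : MemLp X 2 P)
    (b : L2SqVec n T₁ T₂) :
    ⟪b, ∫ ω, tensorVec (V ω) (X ω) ∂P⟫_ℝ = ∫ ω, ⟪V ω, regOp b (X ω)⟫_ℝ ∂P := by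
  rw [← integral_inner (integrable_tensorVec hV hX)]
  simp only [← inner_regOp, real_inner_comm]

/-- The normal equations: the residual of `β₀` is uncorrelated with the covariates as soon as `β₀` has
the right coefficients against `φₖ ⊗ ψₗ`, since `Ker 𝒦` is the orthogonal complement of the `ψₗ`. -/
theorem integral_tensorVec_residual_eq_zero (hY : MemLp Y 2 P) (hX : MemLp X 2 P)
    (φ : HilbertBasis ℕ ℝ (L2 T₁ T₂)) (hψ : IsEigenfamily (covOp P X) ψ) (β₀ : L2SqVec n T₁ T₂)
    (hβ₀ : ∀ k l, ∫ ω, ⟪Y ω, φ k⟫_ℝ * ⟪X ω, ψ l⟫_ℝ ∂P =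
      ⟪β₀, tensorVec (φ k) (ψ l)⟫_ℝ * ∫ ω, ⟪X ω, ψ l⟫_ℝ ^ 2 ∂P) :
    ∫ ω, tensorVec (Y ω - regOp β₀ (X ω)) (X ω) ∂P = 0 := by
  have hV : MemLp (fun ω => Y ω - regOp β₀ (X ω)) 2 P := hY.sub (memLp_regOp hX β₀)
  set D := ∫ ω, tensorVec (Y ω - regOp β₀ (X ω)) (X ω) ∂P with hD
  have hDfg : ∀ f g, ⟪D, tensorVec f g⟫_ℝ =
      ∫ ω, ⟪Y ω - regOp β₀ (X ω), f⟫_ℝ * ⟪X ω, g⟫_ℝ ∂P := fun f g => by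
    rw [hD, real_inner_comm, ← integral_inner (integrable_tensorVec hV hX)]
    simp only [inner_tensorVec_tensorVec, real_inner_comm]
  -- On `Ker 𝒦` the score `⟨X, g⟩` vanishes almost surely.
  have hker : ∀ f, ∀ g ∈ LinearMap.ker (covOp P X), ⟪D, tensorVec f g⟫_ℝ = 0 := by
    intro f g hg
    rw [LinearMap.mem_ker, covOp_eq_zero_iff hX,
      integral_eq_zero_iff_of_nonneg (fun ω => sq_nonneg _) (hX.inner_const g).integrable_sq] at hg
    rw [hDfg]
    refine integral_eq_zero_of_ae ?_
    filter_upwards [hg] with ω hω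
    rw [pow_eq_zero_iff two_ne_zero |>.1 hω, mul_zero, Pi.zero_apply]
  have hbasis : ∀ k l, ⟪D, tensorVec (φ k) (ψ l)⟫_ℝ = 0 := by
    intro k l
    obtain ⟨α, -, hα⟩ := hψ.eigen l
    -- As `ψₗ` is a unit vector, its eigenvalue is the variance of its score.
    have hαv : α = ∫ ω, ⟪X ω, ψ l⟫_ℝ ^ 2 ∂P := by
      have := inner_covOp hX (ψ l) (ψ l)
      rw [hα, inner_smul_left, real_inner_self_eq_norm_sq, hψ.orthonormal.1 l] at this
      simpa [sq] using this
    rw [hDfg]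
    simp only [inner_sub_left, sub_mul, inner_regOp_eq_slice]
    rw [integral_sub (integrable_inner_mul_inner hY hX _ _)
      (integrable_inner_mul_inner hX hX _ _), hβ₀, ← hαv]
    simp only [mul_comm ⟪X _, slice _ _⟫_ℝ]
    rw [← inner_covOp hX, hα, inner_smul_left, inner_slice]
    simp [mul_comm]
  have hψD : ∀ f l, ⟪D, tensorVec f (ψ l)⟫_ℝ = 0 := by
    intro f l
    have h : (ContinuousLinearMap.adjoint ((tensorVecL n).flip (ψ l))) D = 0 := by
      refine φ.repr.map_eq_zero_iff.1 (lp.ext (funext fun k => ?_))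
      rw [φ.repr_apply_apply, ContinuousLinearMap.adjoint_inner_right, real_inner_comm]
      exact hbasis k l
    have h1 := ContinuousLinearMap.adjoint_inner_right ((tensorVecL n).flip (ψ l)) f D
    rw [h, inner_zero_right, real_inner_comm] at h1
    exact h1.symm
  refine eq_zero_of_inner_tensorVec fun f g => ?_
  -- `slice f D` is orthogonal to all `ψₗ`, hence in `Ker 𝒦`, and orthogonal to `Ker 𝒦`.
  have hmem : slice f D ∈ LinearMap.ker (covOp P X) := by
    rw [← hψ.exhaust, Submodule.mem_orthogonal]
    intro u hu
    induction hu using Submodule.span_induction with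
    | mem x hx => obtain ⟨l, rfl⟩ := hx; rw [inner_slice, hψD]
    | zero => simp
    | add x y _ _ hx hy => rw [inner_add_left, hx, hy, add_zero]
    | smul a x _ hx => rw [inner_smul_left, hx, mul_zero]
  have h0 : slice f D = 0 := by
    rw [← inner_self_eq_zero (𝕜 := ℝ), inner_slice, hker f _ hmem]
  rw [← inner_slice, h0, inner_zero_right]

/-- Pythagoras for the risk around a solution of the normal equations. -/
theorem integral_norm_residual_sq_add (hY : MemLp Y 2 P) (hX : MemLp X 2 P)
    {β₀ : L2SqVec n T₁ T₂} (h0 : ∫ ω, tensorVec (Y ω - regOp β₀ (X ω)) (X ω) ∂P = 0)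
    (b : L2SqVec n T₁ T₂) :
    ∫ ω, ‖Y ω - regOp (β₀ + b) (X ω)‖ ^ 2 ∂P =
      ∫ ω, ‖Y ω - regOp β₀ (X ω)‖ ^ 2 ∂P + ∫ ω, ‖regOp b (X ω)‖ ^ 2 ∂P := by
  have hV : MemLp (fun ω => Y ω - regOp β₀ (X ω)) 2 P := hY.sub (memLp_regOp hX β₀)
  have hB := memLp_regOp hX b
  have hc : ∫ ω, ⟪Y ω - regOp β₀ (X ω), regOp b (X ω)⟫_ℝ ∂P = 0 := by
    rw [← inner_integral_tensorVec hV hX, h0, inner_zero_right]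
  have hi1 : Integrable (fun ω => ‖Y ω - regOp β₀ (X ω)‖ ^ 2) P := integrable_norm_sq hV
  have hi2 : Integrable (fun ω => ⟪Y ω - regOp β₀ (X ω), regOp b (X ω)⟫_ℝ) P :=
    memLp_one_iff_integrable.1 ((innerSL ℝ).memLp_of_bilin 1 hV hB)
  have hi3 : Integrable (fun ω => ‖regOp b (X ω)‖ ^ 2) P := integrable_norm_sq hB
  have hexp : ∀ ω, ‖Y ω - regOp (β₀ + b) (X ω)‖ ^ 2 = ‖Y ω - regOp β₀ (X ω)‖ ^ 2
      - 2 * ⟪Y ω - regOp β₀ (X ω), regOp b (X ω)⟫_ℝ + ‖regOp b (X ω)‖ ^ 2 := fun ω => by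
    rw [regOp_add, add_apply, ← sub_sub, norm_sub_sq_real]
  simp only [hexp]
  have hi4 : Integrable (fun ω => ‖Y ω - regOp β₀ (X ω)‖ ^ 2
      - 2 * ⟪Y ω - regOp β₀ (X ω), regOp b (X ω)⟫_ℝ) P := hi1.sub (hi2.const_mul 2)
  rw [integral_add hi4 hi3, integral_sub hi1 (hi2.const_mul 2),
    integral_const_mul, hc]
  ring

end Optimization

/-! ### Orthonormal expansions -/

theorem orthonormal_tensorVec {n : ℕ} {κ ι : Type*} {φ : κ → L2 T₁ T₂} {ψ : ι → L2Vec n T₁ T₂}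
    (hφ : Orthonormal ℝ φ) (hψ : Orthonormal ℝ ψ) :
    Orthonormal ℝ fun q : κ × ι => tensorVec (φ q.1) (ψ q.2) := by
  classical
  rw [orthonormal_iff_ite] at *
  rintro ⟨k, l⟩ ⟨k', l'⟩
  rw [inner_tensorVec_tensorVec, hφ, hψ]
  by_cases h1 : k = k' <;> by_cases h2 : l = l' <;> simp [h1, h2]

theorem summable_smul_of_orthonormal {ι H : Type*} [NormedAddCommGroup H]
    [InnerProductSpace ℝ H] [CompleteSpace H] {e : ι → H} (he : Orthonormal ℝ e) {c : ι → ℝ}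
    (hc : Summable fun i => c i ^ 2) : Summable fun i => c i • e i := by
  have := (he.orthogonalFamily.summable_iff_norm_sq_summable c).2
    (by simpa using hc)
  simpa using this

theorem inner_eq_coeff_of_hasSum {ι H : Type*} [NormedAddCommGroup H]
    [InnerProductSpace ℝ H] {e : ι → H} (he : Orthonormal ℝ e) {c : ι → ℝ} {x : H}
    (hx : HasSum (fun i => c i • e i) x) (i : ι) : ⟪x, e i⟫_ℝ = c i := by
  classical
  have h := (innerSL ℝ (e i)).hasSum hx
  rw [innerSL_apply_apply, real_inner_comm] at h
  refine h.unique ?_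
  have hfun : (fun j => innerSL ℝ (e i) (c j • e j)) = fun j => if j = i then c i else 0 := by
    funext j
    rw [innerSL_apply_apply, inner_smul_right, orthonormal_iff_ite.1 he]
    by_cases hij : i = j
    · simp [hij]
    · simp [hij, Ne.symm hij]
  exact hfun ▸ hasSum_ite_eq i (c i)

end FunctionalSEM

theorem theorem4p1 {T₁ T₂ : ℝ} (hT : T₁ < T₂) {p : ℕ}
    {Ω : Type*} [MeasurableSpace Ω] (P : Measure Ω) [IsProbabilityMeasure P]
    (S : L2Vec (p + 1) T₁ T₂ →L[ℝ] L2Vec (p + 1) T₁ T₂)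
    (ε : Shift (p + 1) T₁ T₂ P) (hε : ∫ ω, ε ω ∂P = 0)
    (E : ∀ A : Shift (p + 1) T₁ T₂ P, Environment P ε A)
    (𝒜 : Set (Shift (p + 1) T₁ T₂ P)) (γ : ℝ) (hγ : 0 ≤ γ)
    (A : Shift (p + 1) T₁ T₂ P) (hA : √γ • A ∈ closure (shiftSet 𝒜 γ A))
    (φ : HilbertBasis ℕ ℝ (L2 T₁ T₂))
    {ι : Type*} (ψ : ι → L2Vec p T₁ T₂)
    (hψ : IsEigenfamily (covOp (E (√γ • A)).prob ((E (√γ • A)).X S)) ψ)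
    (hsum : Summable fun q : ℕ × ι => coeff E S γ A (φ q.1) (ψ q.2) ^ 2) :
    ∃ β₀ : L2SqVec p T₁ T₂,
      HasSum (fun q : ℕ × ι =>
        coeff E S γ A (φ q.1) (ψ q.2) • tensorVec (φ q.1) (ψ q.2)) β₀ ∧
      minimizers E S (shiftSet 𝒜 γ A) =
        {β | ∃ w ∈ nullSpace (covOp (E (√γ • A)).prob ((E (√γ • A)).X S)), β = β₀ + w} ∧
      ((∃! β, β ∈ minimizers E S (shiftSet 𝒜 γ A)) ↔
        Function.Injective (covOp (E (√γ • A)).prob ((E (√γ • A)).X S))) := by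
  set E' := E (√γ • A) with hE'
  have hY := E'.memLp_Y S
  have hX := E'.memLp_X S
  have hcl := hψ.isClosed_ker
  have hon := orthonormal_tensorVec φ.orthonormal hψ.orthonormal
  obtain ⟨β₀, hβ₀⟩ := summable_smul_of_orthonormal hon hsum
  have hD := integral_tensorVec_residual_eq_zero hY hX φ hψ β₀ fun k l => by
    -- The denominator of the coefficient is the eigenvalue of `ψₗ`, so the division is genuine.
    have hne : ∫ ω, ⟪E'.X S ω, ψ l⟫_ℝ ^ 2 ∂E'.prob ≠ 0 := fun h0 => by
      obtain ⟨α, hα, hαψ⟩ := hψ.eigen l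
      rw [(covOp_eq_zero_iff hX _).2 h0] at hαψ
      exact (smul_ne_zero hα (hψ.orthonormal.ne_zero l)) hαψ.symm
    have hc := inner_eq_coeff_of_hasSum hon hβ₀ (k, l)
    rw [coeff_eq E S hε hγ, ← hE'] at hc
    rw [hc, div_mul_cancel₀ _ hne]
  have hworst : ∀ b, worstRisk E S (shiftSet 𝒜 γ A) (β₀ + b) =
      ENNReal.ofReal (∫ ω, ‖E'.Y S ω - regOp β₀ (E'.X S ω)‖ ^ 2 ∂E'.prob +
        ∫ ω, ‖regOp b (E'.X S ω)‖ ^ 2 ∂E'.prob) := fun b => by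
    rw [worstRisk_eq_risk E S hε 𝒜 hγ hA φ, Environment.risk_eq_ofReal]
    simp only [Environment.residual_state]
    rw [integral_norm_residual_sq_add hY hX hD]
  have hmin : minimizers E S (shiftSet 𝒜 γ A) =
      {β | ∃ w ∈ nullSpace (covOp E'.prob (E'.X S)), β = β₀ + w} := by
    have hnn : ∀ b, 0 ≤ ∫ ω, ‖regOp b (E'.X S ω)‖ ^ 2 ∂E'.prob := fun b =>
      integral_nonneg fun _ => sq_nonneg _
    have hnn' : 0 ≤ ∫ ω, ‖E'.Y S ω - regOp β₀ (E'.X S ω)‖ ^ 2 ∂E'.prob :=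
      integral_nonneg fun _ => sq_nonneg _
    ext β
    obtain ⟨b, rfl⟩ : ∃ b, β = β₀ + b := ⟨β - β₀, by abel⟩
    have hb : β₀ + b ∈ {β | ∃ w ∈ nullSpace (covOp E'.prob (E'.X S)), β = β₀ + w} ↔
        b ∈ nullSpace (covOp E'.prob (E'.X S)) :=
      ⟨fun ⟨w, hw, h⟩ => add_left_cancel h ▸ hw, fun h => ⟨b, h, rfl⟩⟩
    rw [hb, ← integral_norm_regOp_sq_eq_zero_iff hX φ hcl]
    constructor
    · intro h
      have h1 := h (β₀ + 0)
      rw [hworst, hworst, ENNReal.ofReal_le_ofReal_iff (add_nonneg hnn' (hnn 0))] at h1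
      have h2 : ∫ ω, ‖regOp 0 (E'.X S ω)‖ ^ 2 ∂E'.prob = 0 :=
        (integral_norm_regOp_sq_eq_zero_iff hX φ hcl 0).2 (Submodule.zero_mem _)
      linarith [hnn b]
    · intro h β'
      obtain ⟨b', rfl⟩ : ∃ b', β' = β₀ + b' := ⟨β' - β₀, by abel⟩
      rw [hworst, hworst, h]
      exact ENNReal.ofReal_le_ofReal (add_le_add_right (hnn b') _)
  refine ⟨β₀, hβ₀, hmin, ?_⟩
  rw [hmin, ← LinearMap.ker_eq_bot, Submodule.eq_bot_iff]
  constructor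
  · rintro ⟨β, -, hβ⟩ η hη
    have h1 := hβ β₀ ⟨0, Submodule.zero_mem _, (add_zero _).symm⟩
    have h2 := hβ (β₀ + tensorVec (φ 0) η) ⟨_, Submodule.le_topologicalClosure _
      (Submodule.subset_span ⟨φ 0, η, hη, rfl⟩), rfl⟩
    have h3 : tensorVec (φ 0) η = 0 := by rwa [← h1, add_eq_left] at h2
    rw [← norm_eq_zero, norm_tensorVec, φ.orthonormal.1 0, one_mul] at h3
    exact norm_eq_zero.1 h3
  · intro hker
    refine ⟨β₀, ⟨0, Submodule.zero_mem _, (add_zero _).symm⟩, ?_⟩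
    rintro _ ⟨w, hw, rfl⟩
    have hw0 : w = 0 := eq_zero_of_inner_tensorVec fun f g => by
      rw [← inner_slice, hker _ ((mem_nullSpace_iff hcl w).1 hw f), inner_zero_right]
    rw [hw0, add_zero]
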